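/- Let $G$ be a compact Hausdorff topological group with a countable basis, and let $\mu=(\mu_k)_{k\in-\mathbb N}$, $-\mathbb N=\{0,-1,-2,\dots\}$, be a family of Borel probability measures on $G$. A solution (with noise law $\mu$) is a pair of $G$-valued processes $\{(\eta_k),(\xi_k)\}$ indexed by $-\mathbb N$ on a common probability space such that for every $k\in-\mathbb N$: $\eta_k=\xi_k\eta_{k-1}$ a.s., $\xi_k$ is independent of $\sigma(\eta_m: m\le k-1)$, and $\xi_k$ has law $\mu_k$. Let $\mathcal P_\mu$ be the set of the laws on $G^{-\mathbb N}$ of $(\eta_k)$ for all solutions; a solution is called extremal if the law of $(\eta_k)$ is an extreme point of the convex set $\mathcal P_\mu$. For a compact subgroup $H$, let $G/H$ be the space of left cosets $gH$ with the quotient topology. For any extremal solution $\{(\eta^0_k),(\xi_k)\}$ there exist a sequence $(\alpha_l)_{l\in-\mathbb N}$ of deterministic elements of $G$ and a compact subgroup $H$ of $G$ such that: (E1) for each $k\in-\mathbb N$, $\xi_k\xi_{k-1}\cdots\xi_l\,\alpha_l\to\eta^0_k$ in law as $l\to-\infty$; (E2) $\alpha_l^{-1}\eta^0_{l-1}\to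 U_H$ in law as $l\to-\infty$, where $U_H$ is distributed according to the normalized Haar measure on $H$; (E3) for each $h\in H$, the processes $(\eta^0_k h)_{k\in-\mathbb N}$ and $(\eta^0_k)_{k\in-\mathbb N}$ have the same law; (E4) for each $k\in-\mathbb N$, $\xi_k\xi_{k-1}\cdots\xi_l\,\alpha_l H\to\eta^0_k H$ almost surely in $G/H$ as $l\to-\infty$. Moreover, suppose that an extremal solution $\{(\eta^0_k),(\xi_k)\}$ satisfies (E1)-(E4) with $(\alpha_l)$ and $H$, and that another extremal solution $\{(\tilde\eta^0_k),(\tilde\xi_k)\}$ with the same noise law $\mu$, possibly on another probability space, satisfies (E1)-(E4) with $(\tilde\alpha_l)$ and $\tilde H$. Then for every accumulation point $g$ of the sequence $(\alpha_l^{-1}\tilde\alpha_l)$ as $l\to-\infty$ (that is, every limit along a subsequence), the processes $(\tilde\eta^0_k)$ and $(\eta^0_k g)$ have the same law, and $\tilde H=g^{-1}Hg$. -/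

import Mathlib

open MeasureTheory ProbabilityTheory Filter Topology
open scoped NNReal

universe u v

/-! The time set `-ℕ = {0, -1, -2, …}` is indexed by `ℕ`: the index `n` stands for the time `-n`.
So the predecessor `k - 1` of the time `k = -n` has index `n + 1`, `m ≤ k` for times means `n ≤ m`
for indices, and `l → -∞` is `atTop`. -/

namespace BackwardEquation

variable {G : Type u} [Group G] [TopologicalSpace G] [MeasurableSpace G]

/-- The σ-field `σ(η_m : m ≤ k)` of the past of a process up to the time `k = -n`. -/
@[reducible] def past {Ω : Type v} (η : ℕ → Ω → G) (n : ℕ) : MeasurableSpace Ω :=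
  ⨆ m, ⨆ _ : n ≤ m, MeasurableSpace.comap (η m) inferInstance

/-- `{(η_k), (ξ_k)}`, defined on the probability space `(Ω, P)`, is a solution of
`η_k = ξ_k η_{k-1}` with noise law `μ`. -/
structure IsSolution (μ : ℕ → ProbabilityMeasure G) {Ω : Type v} [MeasurableSpace Ω]
    (P : Measure Ω) (η ξ : ℕ → Ω → G) : Prop where
  measurable_eta : ∀ n, Measurable (η n)
  measurable_xi : ∀ n, Measurable (ξ n)
  equation : ∀ n, ∀ᵐ ω ∂P, η n ω = ξ n ω * η (n + 1) ω
  indep : ∀ n, Indep (MeasurableSpace.comap (ξ n) inferInstance) (past η (n + 1)) P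
  noise_law : ∀ n, P.map (ξ n) = (μ n : Measure G)

/-- The law of a process, as a measure on the path space. -/
noncomputable def pathLaw {Ω : Type v} [MeasurableSpace Ω] (P : Measure Ω) (η : ℕ → Ω → G) :
    Measure (ℕ → G) :=
  P.map (fun ω n => η n ω)

/-- The set of the laws of `(η_k)` over all solutions with noise law `μ`. Probability spaces in the
universe of `G` suffice, see `IsSolution.pathLaw_mem`. -/
def solutionLaws (μ : ℕ → ProbabilityMeasure G) : Set (Measure (ℕ → G)) :=
  {Q | ∃ (Ω : Type u) (_ : MeasurableSpace Ω) (P : Measure Ω) (_ : IsProbabilityMeasure P)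
    (η ξ : ℕ → Ω → G), IsSolution μ P η ξ ∧ pathLaw P η = Q}

/-- A solution is extremal if the law of `(η_k)` is an extreme point of the set of the laws of
solutions. -/
structure IsExtremalSolution (μ : ℕ → ProbabilityMeasure G) {Ω : Type v} [MeasurableSpace Ω]
    (P : Measure Ω) (η ξ : ℕ → Ω → G) : Prop where
  isSolution : IsSolution μ P η ξ
  extremal : pathLaw P η ∈ (solutionLaws μ).extremePoints ℝ≥0

/-- The product `ξ_k ξ_{k-1} ⋯ ξ_l` for `k = -n`, `l = -m`, `n ≤ m`. -/
def noiseProd {Ω : Type v} (ξ : ℕ → Ω → G) (n m : ℕ) (ω : Ω) : G :=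
  ((List.Ico n (m + 1)).map (fun i => ξ i ω)).prod

/-- The normalized Haar measure of a compact subgroup. -/
noncomputable def uniform [IsTopologicalGroup G] [BorelSpace G] (H : Subgroup G) [CompactSpace H] :
    Measure H :=
  haveI : BorelSpace H := Subtype.borelSpace (H : Set G)
  Measure.haarMeasure (⊤ : TopologicalSpace.PositiveCompacts H)

instance [IsTopologicalGroup G] [BorelSpace G] (H : Subgroup G) [CompactSpace H] :
    IsProbabilityMeasure (uniform H) :=
  haveI : BorelSpace H := Subtype.borelSpace (H : Set G)
  ⟨Measure.haarMeasure_self⟩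

/-- The four conditions on a pair of processes, a sequence `(α_l)` in `G` and a compact
subgroup `H`. -/
structure Conditions [IsTopologicalGroup G] [BorelSpace G] {Ω : Type v} [MeasurableSpace Ω]
    (P : Measure Ω) [IsProbabilityMeasure P] (η ξ : ℕ → Ω → G) (α : ℕ → G)
    (H : Subgroup G) [CompactSpace H] : Prop where
  /-- `ξ_k ξ_{k-1} ⋯ ξ_l α_l → η_k` in law. -/
  E1 : ∀ n, TendstoInDistribution (fun m ω => noiseProd ξ n m ω * α m) atTop (η n) (fun _ => P) P
  /-- `α_l⁻¹ η_{l-1} → U_H` in law, where `U_H` is uniform on `H`. -/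
  E2 : TendstoInDistribution (fun m ω => (α m)⁻¹ * η (m + 1) ω) atTop
    (fun h : H => (h : G)) (fun _ => P) (uniform H)
  /-- `(η_k h)` and `(η_k)` have the same law, for all `h ∈ H`. -/
  E3 : ∀ h ∈ H, pathLaw P (fun n ω => η n ω * h) = pathLaw P η
  /-- `ξ_k ξ_{k-1} ⋯ ξ_l α_l H → η_k H` almost surely in the space of left cosets. -/
  E4 : ∀ n, ∀ᵐ ω ∂P, Tendsto (fun m => ((noiseProd ξ n m ω * α m : G) : G ⧸ H)) atTop
    (𝓝 ((η n ω : G) : G ⧸ H))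

/-- The law of a solution on an arbitrary probability space, of any universe, is realized by the
coordinate processes on `(ℕ → G) × (ℕ → G)`. -/
theorem IsSolution.pathLaw_mem [IsTopologicalGroup G] [SecondCountableTopology G] [BorelSpace G]
    [T2Space G] {μ : ℕ → ProbabilityMeasure G} {Ω : Type v} [MeasurableSpace Ω] {P : Measure Ω}
    [IsProbabilityMeasure P] {η ξ : ℕ → Ω → G} (h : IsSolution μ P η ξ) :
    pathLaw P η ∈ solutionLaws μ := by
  have hη := h.measurable_eta
  have hξ := h.measurable_xi
  let F : Ω → (ℕ → G) × (ℕ → G) := fun ω => (fun n => η n ω, fun n => ξ n ω)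
  have hF : Measurable F := by fun_prop
  refine ⟨(ℕ → G) × (ℕ → G), inferInstance, P.map F, Measure.isProbabilityMeasure_map
    hF.aemeasurable, fun n x => x.1 n, fun n x => x.2 n, ⟨by fun_prop, by fun_prop, fun n => ?_,
    fun n => ?_, fun n => ?_⟩, ?_⟩
  · refine (ae_map_iff hF.aemeasurable (measurableSet_eq_fun (by fun_prop) (by fun_prop))).2 ?_
    exact h.equation n
  · rw [Indep_iff]
    have hle : past (fun n (x : (ℕ → G) × (ℕ → G)) => x.1 n) (n + 1) ≤ Prod.instMeasurableSpace :=
      iSup₂_le fun m _ => Measurable.comap_le (by fun_prop)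
    have hpast : MeasurableSpace.comap F (past (fun n (x : (ℕ → G) × (ℕ → G)) => x.1 n) (n + 1))
        = past η (n + 1) := by
      simp only [past, MeasurableSpace.comap_iSup, MeasurableSpace.comap_comp]
      rfl
    rintro s t ⟨s', hs', rfl⟩ ht
    have hs : MeasurableSet ((fun x : (ℕ → G) × (ℕ → G) => x.2 n) ⁻¹' s') :=
      (by fun_prop : Measurable fun x : (ℕ → G) × (ℕ → G) => x.2 n) hs'
    rw [Measure.map_apply hF (hs.inter (hle _ ht)), Measure.map_apply hF hs,
      Measure.map_apply hF (hle _ ht)]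
    refine (Indep_iff _ _ _).1 (h.indep n) _ _ ⟨s', hs', rfl⟩ ?_
    rw [← hpast]
    exact ⟨t, ht, rfl⟩
  · rw [← h.noise_law n, Measure.map_map (by fun_prop) hF]
    rfl
  · simp only [pathLaw]
    rw [Measure.map_map (by fun_prop) hF]
    rfl

end BackwardEquation

open BackwardEquation

/-! Conditioning a solution on an event of the remote past `⨅ n, past η n` gives a solution again,
so for an extremal solution the remote past is trivial. By reverse martingale convergence the
conditional expectation of `φ(η_k)` given the past up to `l - 1`, which is
`∫ φ(ξ_k ⋯ ξ_l η_{l-1}(ω))` with the integral over the noise only, then tends to the mean of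
`φ(η_k)` in `L¹`. Taking `α_l = η_{l-1}(ω_l)` at a point `ω_l` where this is close to the limit, for
countably many `φ` at once, gives (E1).

Let `H` be the group of right translations preserving all the marginals. The law `ν_k` of `η_k`
is the convolution of the laws of `ξ_k ⋯ ξ_l α_l` and `α_l⁻¹ η_{l-1}`, so a cluster point `κ` of the
laws of the latter satisfies `ν_k * κ = ν_k`. A Choquet–Deny argument in `L²` of the Haar measure
shows that `κ` is carried by `H`; as it is also invariant under right translations by `H`, it is
uniform, which is (E2). For (E4), test against functions `φ` on `G/H`: the martingale
`E[φ(η_k) | ξ_k, …, ξ_l]` converges almost surely, and by (E2) it differs from `φ(ξ_k ⋯ ξ_l α_l)` by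
a quantity tending to `0` uniformly.

The law of a solution is determined by its marginals, which gives (E3), and (E1) compares the
marginals of two solutions along a subsequence of `α_l⁻¹ β_l`, where `β_l` is the second centring
sequence. Since (E2) and (E3) force `H` to be the stabilizer of the marginals, the two subgroups
are conjugate. -/

namespace BackwardEquation

section ReverseMartingale

theorem tendsto_starProjection_iInf {E : Type*} [NormedAddCommGroup E] [InnerProductSpace ℝ E]
    [CompleteSpace E] {U : ℕ → Submodule ℝ E} [∀ n, (U n).HasOrthogonalProjection]
    [(⨅ n, U n).HasOrthogonalProjection] (hU : Antitone U) (x : E) :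
    Tendsto (fun n => (U n).starProjection x) atTop (𝓝 ((⨅ n, U n).starProjection x)) := by
  have horth : (⨆ n, (U n)ᗮ).topologicalClosure = (⨅ n, U n)ᗮ := by
    rw [← Submodule.orthogonal_orthogonal_eq_closure, ← Submodule.iInf_orthogonal]
    simp only [Submodule.orthogonal_orthogonal]
  have := Submodule.starProjection_tendsto_closure_iSup (fun n => (U n)ᗮ)
    (fun _ _ hab => Submodule.orthogonal_le (hU hab)) x
  simpa [horth, Submodule.starProjection_orthogonal] using this.const_sub x

theorem condExp_ae_eq_integral_of_trivial {Ω : Type*} {m mΩ : MeasurableSpace Ω}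
    {P : Measure Ω} [IsProbabilityMeasure P] (hm : m ≤ mΩ)
    (htriv : ∀ A, MeasurableSet[m] A → P A = 0 ∨ P A = 1) {X : Ω → ℝ}
    (hX : AEStronglyMeasurable X P) : P[X | m] =ᵐ[P] fun _ => ∫ ω, X ω ∂P := by
  rw [integral_congr_ae hX.ae_eq_mk]
  refine (condExp_congr_ae hX.ae_eq_mk).trans <| condExp_indep_eq
    hX.stronglyMeasurable_mk.measurable.comap_le hm
    (comap_measurable (hX.mk X)).stronglyMeasurable ((Indep_iff _ _ _).2 fun s t _ ht => ?_)
  rcases htriv t ht with h | h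
  · rw [measure_inter_null_of_null_right s h, h, mul_zero]
  · rw [h, mul_one, measure_inter_conull ((prob_compl_eq_zero_iff (hm t ht)).2 h)]

variable {Ω : Type*} {mΩ : MeasurableSpace Ω} {P : Measure Ω} {F : ℕ → MeasurableSpace Ω}

theorem aestronglyMeasurable_iInf (hF : Antitone F) {y : Ω → ℝ}
    (hy : ∀ n, AEStronglyMeasurable[F n] y P) : AEStronglyMeasurable[⨅ n, F n] y P := by
  choose g hg hyg using hy
  let z : Ω → ℝ := fun ω => limsup (fun n => g n ω) atTop
  have hz : ∀ k, Measurable[F k] z := fun k => by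
    have hshift : z = fun ω => limsup (fun n => g (n + k) ω) atTop :=
      funext fun ω => (limsup_nat_add (fun n => g n ω) k).symm
    rw [hshift]
    exact Measurable.limsup fun n => ((hg (n + k)).mono (hF (Nat.le_add_left k n))).measurable
  have hzm : Measurable[⨅ n, F n] z := fun s hs =>
    MeasurableSpace.measurableSet_iInf.2 fun k => hz k hs
  refine ⟨z, hzm.stronglyMeasurable, ?_⟩
  filter_upwards [ae_all_iff.2 hyg] with ω hω
  simp only [z, ← hω, limsup_const]

theorem iInf_lpMeas (hF : Antitone F) :
    ⨅ n, lpMeas ℝ ℝ (F n) 2 P = lpMeas ℝ ℝ (⨅ n, F n) 2 P := by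
  ext x
  simp only [Submodule.mem_iInf, mem_lpMeas_iff_aestronglyMeasurable]
  exact ⟨aestronglyMeasurable_iInf hF, fun h n => h.mono (iInf_le F n)⟩

theorem tendsto_eLpNorm_condExp_iInf [IsFiniteMeasure P] (hF : Antitone F)
    (hle : ∀ n, F n ≤ mΩ) {X : Ω → ℝ} (hX : MemLp X 2 P) :
    Tendsto (fun n => eLpNorm (P[X | F n] - P[X | ⨅ n, F n]) 2 P) atTop (𝓝 0) := by
  have hfact : ∀ n, Fact (F n ≤ mΩ) := fun n => ⟨hle n⟩
  have hleI : ⨅ n, F n ≤ mΩ := (iInf_le F 0).trans (hle 0)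
  have hfactI : Fact (⨅ n, F n ≤ mΩ) := ⟨hleI⟩
  have : (⨅ n, lpMeas ℝ ℝ (F n) 2 P).HasOrthogonalProjection := by
    rw [iInf_lpMeas hF]
    infer_instance
  have hanti : Antitone fun n => lpMeas ℝ ℝ (F n) 2 P := fun a b hab x hx => by
    rw [mem_lpMeas_iff_aestronglyMeasurable] at hx ⊢
    exact hx.mono (hF hab)
  have hlim := tendsto_starProjection_iInf hanti (hX.toLp X)
  simp only [iInf_lpMeas hF] at hlim
  refine ((Lp.tendsto_Lp_iff_tendsto_eLpNorm' _ _).1 hlim).congr fun n => eLpNorm_congr_ae ?_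
  exact (hX.condExpL2_ae_eq_condExp (𝕜 := ℝ) (hle n)).sub
    (hX.condExpL2_ae_eq_condExp (𝕜 := ℝ) hleI)

theorem tendsto_lintegral_condExp_of_trivial_iInf [IsProbabilityMeasure P] (hF : Antitone F)
    (hle : ∀ n, F n ≤ mΩ) (htriv : ∀ A, MeasurableSet[⨅ n, F n] A → P A = 0 ∨ P A = 1)
    {X : Ω → ℝ} (hX : MemLp X 2 P) :
    Tendsto (fun n => ∫⁻ ω, ‖(P[X | F n]) ω - ∫ ω', X ω' ∂P‖ₑ ∂P) atTop (𝓝 0) := by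
  have hleI : ⨅ n, F n ≤ mΩ := (iInf_le F 0).trans (hle 0)
  refine tendsto_of_tendsto_of_tendsto_of_le_of_le tendsto_const_nhds
    (tendsto_eLpNorm_condExp_iInf hF hle hX) (fun _ => zero_le) fun n => ?_
  have hcongr : P[X | F n] - P[X | ⨅ n, F n] =ᵐ[P] P[X | F n] - fun _ => ∫ ω, X ω ∂P :=
    EventuallyEq.rfl.sub (condExp_ae_eq_integral_of_trivial hleI htriv hX.1)
  calc ∫⁻ ω, ‖(P[X | F n]) ω - ∫ ω', X ω' ∂P‖ₑ ∂P
      = eLpNorm (P[X | F n] - P[X | ⨅ n, F n]) 1 P := by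
        rw [eLpNorm_congr_ae hcongr, eLpNorm_one_eq_lintegral_enorm]
        rfl
    _ ≤ eLpNorm (P[X | F n] - P[X | ⨅ n, F n]) 2 P :=
        eLpNorm_le_eLpNorm_of_exponent_le one_le_two
          (integrable_condExp.sub integrable_condExp).aestronglyMeasurable

end ReverseMartingale

section Independence

variable {Ω : Type*} [MeasurableSpace Ω] {P : Measure Ω} [IsFiniteMeasure P]
  {α β γ : Type*} [MeasurableSpace α] [MeasurableSpace β] [MeasurableSpace γ]

theorem indepFun_prodMk_left {A : Ω → α} {B : Ω → β} {C : Ω → γ} (hA : Measurable A)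
    (hB : Measurable B) (hC : Measurable C) (h : IndepFun A (fun ω => (B ω, C ω)) P)
    (hBC : IndepFun B C P) : IndepFun (fun ω => (A ω, B ω)) C P := by
  have hAB : IndepFun A B P := h.comp measurable_id measurable_fst
  rw [indepFun_iff_map_prod_eq_prod_map_map (by fun_prop) (by fun_prop)] at *
  rw [hBC] at h
  rw [hAB, ← ((measurePreserving_prodAssoc (P.map A) (P.map B) (P.map C)).symm
    MeasurableEquiv.prodAssoc).map_eq, ← h, Measure.map_map (by fun_prop) (by fun_prop)]
  rfl

theorem condExp_comap_ae_eq_integral {E : Type*} [NormedAddCommGroup E] [NormedSpace ℝ E]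
    [CompleteSpace E] {X : Ω → α} {Y : Ω → β} (hX : Measurable X) (hY : Measurable Y)
    (h : IndepFun X Y P) {f : α × β → E} (hf : Integrable f ((P.map X).prod (P.map Y))) :
    P[fun ω => f (X ω, Y ω) | MeasurableSpace.comap X inferInstance] =ᵐ[P]
      fun ω => ∫ ω', f (X ω, Y ω') ∂P := by
  have hmap := (indepFun_iff_map_prod_eq_prod_map_map hX.aemeasurable hY.aemeasurable).1 h
  have hXY : Integrable (fun ω => f (X ω, Y ω)) P := by
    rw [← hmap] at hf
    exact hf.comp_measurable (by fun_prop)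
  have hg : Integrable (fun x => ∫ y, f (x, y) ∂P.map Y) (P.map X) := hf.integral_prod_left
  have hcongr : ∀ᵐ ω ∂P, ∫ y, f (X ω, y) ∂P.map Y = ∫ ω', f (X ω, Y ω') ∂P := by
    filter_upwards [ae_of_ae_map hX.aemeasurable hf.1.prodMk_left] with ω hω
    exact integral_map hY.aemeasurable hω
  have hgX : AEStronglyMeasurable[MeasurableSpace.comap X inferInstance]
      (fun ω => ∫ y, f (X ω, y) ∂P.map Y) P :=
    ⟨fun ω => hg.1.mk _ (X ω), hg.1.stronglyMeasurable_mk.comp_measurable (comap_measurable X),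
      ae_of_ae_map hX.aemeasurable hg.1.ae_eq_mk⟩
  refine EventuallyEq.trans (.symm ?_) hcongr
  refine ae_eq_condExp_of_forall_setIntegral_eq hX.comap_le hXY
    (fun _ _ _ => (hg.comp_measurable hX).integrableOn) ?_ hgX
  rintro _ ⟨t, ht, rfl⟩ -
  calc ∫ ω in X ⁻¹' t, ∫ y, f (X ω, y) ∂P.map Y ∂P
      = ∫ x in t, ∫ y, f (x, y) ∂P.map Y ∂P.map X :=
        (setIntegral_map ht hg.1 hX.aemeasurable).symm
    _ = ∫ p in t ×ˢ Set.univ, f p ∂(P.map X).prod (P.map Y) := by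
        rw [setIntegral_prod _ hf.integrableOn, Measure.restrict_univ]
    _ = ∫ ω in X ⁻¹' t, f (X ω, Y ω) ∂P := by
        rw [← hmap] at hf ⊢
        rw [setIntegral_map (ht.prod .univ) hf.1 (by fun_prop), Set.mk_preimage_prod,
          Set.preimage_univ, Set.inter_univ]

end Independence

theorem exists_seq_forall_tendsto_zero {Ω : Type*} [MeasurableSpace Ω] {P : Measure Ω}
    [IsProbabilityMeasure P] {f : ℕ → ℕ → Ω → ENNReal} (hf : ∀ i m, Measurable (f i m))
    (h : ∀ i, Tendsto (fun m => ∫⁻ ω, f i m ω ∂P) atTop (𝓝 0)) :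
    ∃ x : ℕ → Ω, ∀ i, Tendsto (fun m => f i m (x m)) atTop (𝓝 0) := by
  let c : ℕ → ENNReal := fun i => 2⁻¹ ^ i
  have hc : ∑' i, c i ≠ ⊤ := by simp [c, ENNReal.tsum_geometric]
  have hmin : ∀ i, Tendsto (fun m => ∫⁻ ω, min (c i) (f i m ω) ∂P) atTop (𝓝 0) := fun i =>
    tendsto_of_tendsto_of_tendsto_of_le_of_le tendsto_const_nhds (h i) (fun _ => zero_le)
      fun m => lintegral_mono fun ω => min_le_right _ _
  have hsum : Tendsto (fun m => ∫⁻ ω, ∑' i, min (c i) (f i m ω) ∂P) atTop (𝓝 0) := by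
    have hswap : ∀ m, ∫⁻ ω, ∑' i, min (c i) (f i m ω) ∂P
        = ∫⁻ i, ∫⁻ ω, min (c i) (f i m ω) ∂P ∂Measure.count := fun m => by
      rw [lintegral_tsum fun i => by fun_prop, lintegral_count]
    simp_rw [hswap]
    rw [← lintegral_zero (μ := Measure.count (α := ℕ))]
    refine tendsto_lintegral_of_dominated_convergence c (fun m => measurable_of_countable _)
      (fun m => .of_forall fun i => ?_) (by rwa [lintegral_count]) (.of_forall hmin)
    exact (lintegral_mono fun ω => min_le_left (c i) _).trans_eq (by simp)
  choose x hx using fun m => exists_le_lintegral (μ := P)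
    (f := fun ω => ∑' i, min (c i) (f i m ω)) (by fun_prop)
  refine ⟨x, fun i => ?_⟩
  have hi : Tendsto (fun m => min (c i) (f i m (x m))) atTop (𝓝 0) :=
    tendsto_of_tendsto_of_tendsto_of_le_of_le tendsto_const_nhds hsum (fun _ => zero_le)
      fun m => (ENNReal.le_tsum i).trans (hx m)
  refine hi.congr' ?_
  filter_upwards [hi.eventually_lt_const (ENNReal.pow_pos (by simp) i : 0 < c i)] with m hm
  exact min_eq_right ((min_lt_iff.1 hm).resolve_left (lt_irrefl _)).le

section WeakConvergence

variable {X : Type*} [TopologicalSpace X] [CompactSpace X] [MeasurableSpace X]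
  [OpensMeasurableSpace X] {ι γ : Type*} {L : Filter γ} {φ : ι → C(X, ℝ)}

theorem lipschitzWith_integral (ν : Measure X) [IsProbabilityMeasure ν] :
    LipschitzWith 1 fun f : C(X, ℝ) => ∫ x, f x ∂ν := by
  refine LipschitzWith.of_dist_le_mul fun f g => ?_
  rw [dist_eq_norm, ← integral_sub (f.continuous.integrable_of_hasCompactSupport
    (.of_compactSpace _)) (g.continuous.integrable_of_hasCompactSupport (.of_compactSpace _)),
    NNReal.coe_one, one_mul]
  refine (norm_integral_le_of_norm_le_const (C := dist f g) (.of_forall fun x => ?_)).trans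
    (by simp)
  rw [← dist_eq_norm]
  exact ContinuousMap.dist_apply_le_dist x

theorem tendsto_of_forall_dense_integral (hφ : DenseRange φ) {ν : γ → ProbabilityMeasure X}
    {ν₀ : ProbabilityMeasure X}
    (h : ∀ i, Tendsto (fun m => ∫ x, φ i x ∂(ν m : Measure X)) L
      (𝓝 (∫ x, φ i x ∂(ν₀ : Measure X)))) : Tendsto ν L (𝓝 ν₀) := by
  refine ProbabilityMeasure.tendsto_iff_forall_integral_tendsto.2 fun f => ?_
  have hequi : Equicontinuous fun (m : γ) (f : C(X, ℝ)) => ∫ x, f x ∂(ν m : Measure X) :=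
    (LipschitzWith.uniformEquicontinuous _ 1
      fun m => lipschitzWith_integral (ν m : Measure X)).equicontinuous
  exact (hequi f.toContinuousMap).tendsto_of_mem_closure (s := Set.range φ)
    ((lipschitzWith_integral (ν₀ : Measure X)).continuous.continuousWithinAt)
    (Set.forall_mem_range.2 h) (hφ _)

theorem tendsto_of_forall_dense_apply {X : Type*} [TopologicalSpace X] [CompactSpace X]
    [T2Space X] {φ : ι → C(X, ℝ)} (hφ : DenseRange φ) {x : γ → X} {x₀ : X}
    (h : ∀ i, Tendsto (fun m => φ i (x m)) L (𝓝 (φ i x₀))) : Tendsto x L (𝓝 x₀) := by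
  borelize X
  rw [isEmbedding_diracProba.tendsto_nhds_iff]
  have hd : ∀ i y, ∫ z, φ i z ∂(diracProba y : Measure X) = φ i y := fun i y => integral_dirac _ _
  exact tendsto_of_forall_dense_integral hφ fun i => by
    simpa only [Function.comp_apply, hd] using h i

end WeakConvergence

section Convolution

variable {M : Type*} [Monoid M] [MeasurableSpace M] [MeasurableMul₂ M]

theorem mconv_eq_left_of_ae {ν κ : Measure M} [SFinite ν] [IsProbabilityMeasure κ]
    (h : ∀ᵐ y ∂κ, ν.map (· * y) = ν) : ν ∗ₘ κ = ν := by
  ext A hA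
  have hfib : ∀ᵐ y ∂κ, ν ((· * y) ⁻¹' A) = ν A := h.mono fun y hy => by
    rw [← Measure.map_apply (measurable_mul_const y) hA, hy]
  rw [Measure.mconv, Measure.map_apply measurable_mul hA,
    Measure.prod_apply_symm (measurable_mul hA)]
  exact (lintegral_congr_ae hfib).trans (by simp)

theorem mconv_eq_right_of_ae {ν κ : Measure M} [IsProbabilityMeasure ν] [SFinite κ]
    (h : ∀ᵐ x ∂ν, κ.map (x * ·) = κ) : ν ∗ₘ κ = κ := by
  ext A hA
  have hfib : ∀ᵐ x ∂ν, κ ((x * ·) ⁻¹' A) = κ A := h.mono fun x hx => by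
    rw [← Measure.map_apply (measurable_const_mul x) hA, hx]
  rw [Measure.mconv, Measure.map_apply measurable_mul hA, Measure.prod_apply (measurable_mul hA)]
  exact (lintegral_congr_ae hfib).trans (by simp)

/-- Convolution as an operation on the space of probability measures, which carries the topology
of weak convergence. -/
noncomputable def conv (ν κ : ProbabilityMeasure M) : ProbabilityMeasure M :=
  (ν.prod κ).map measurable_mul.aemeasurable

theorem toMeasure_conv (ν κ : ProbabilityMeasure M) :
    (conv ν κ : Measure M) = (ν : Measure M) ∗ₘ (κ : Measure M) := rfl

theorem toMeasure_conv_diracProba (ν : ProbabilityMeasure M) (g : M) :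
    (conv ν (diracProba g) : Measure M) = (ν : Measure M).map (· * g) :=
  Measure.mconv_dirac _ _

theorem conv_diracProba_eq_self_iff {ν : ProbabilityMeasure M} {g : M} :
    conv ν (diracProba g) = ν ↔ (ν : Measure M).map (· * g) = ν := by
  rw [← ProbabilityMeasure.toMeasure_injective.eq_iff, toMeasure_conv_diracProba]

end Convolution

theorem continuous_conv {M : Type*} [Monoid M] [TopologicalSpace M] [ContinuousMul M]
    [SecondCountableTopology M] [TopologicalSpace.PseudoMetrizableSpace M] [MeasurableSpace M]
    [BorelSpace M] :
    Continuous fun p : ProbabilityMeasure M × ProbabilityMeasure M => conv p.1 p.2 :=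
  (ProbabilityMeasure.continuous_map continuous_mul).comp ProbabilityMeasure.continuous_prod

section ChoquetDeny

variable {G : Type*} [Group G] [TopologicalSpace G] [IsTopologicalGroup G] [CompactSpace G]
  [SecondCountableTopology G] [MeasurableSpace G] [BorelSpace G]

/-- By left invariance of the Haar measure, all translates `Λ (z * ·)` have the same norm in `L²`;
if their mean `Λ` has this norm too, strict convexity forces them to be equal. -/
theorem ae_mul_left_eq_of_forall_integral_eq {κ : Measure G} [IsProbabilityMeasure κ] {Λ : C(G, ℝ)}
    (hΛ : ∀ y, ∫ z, Λ (z * y) ∂κ = Λ y) : ∀ᵐ z ∂κ, ∀ y, Λ (z * y) = Λ y := by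
  let V : Measure G := Measure.haarMeasure ⊤
  let T : C(G, ℝ) →L[ℝ] Lp ℝ 2 V := ContinuousMap.toLp 2 V ℝ
  let τ : C(G, C(G, ℝ)) := ContinuousMap.curry ⟨fun p => Λ (p.1 * p.2), by fun_prop⟩
  have hτ : Integrable τ κ := τ.continuous.integrable_of_hasCompactSupport (.of_compactSpace _)
  have hmean : ∫ z, T (τ z) ∂κ = T Λ := by
    rw [T.integral_comp_comm hτ]
    exact congrArg T (ContinuousMap.ext fun y => (ContinuousMap.integral_apply hτ y).trans (hΛ y))
  have hnorm : ∀ z, ‖T (τ z)‖ = ‖T Λ‖ := fun z => by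
    rw [← Lp.norm_compMeasurePreserving (T Λ) (measurePreserving_mul_left V z)]
    rfl
  rcases ae_eq_const_or_norm_integral_lt_of_norm_le_const (μ := κ) (f := fun z => T (τ z))
    (C := ‖T Λ‖) (.of_forall fun z => (hnorm z).le)
    with hconst | hlt
  · filter_upwards [hconst] with z hz y
    rw [Function.const_apply, average_eq_integral, hmean] at hz
    exact congrArg (· y) (ContinuousMap.toLp_injective V hz)
  · rw [hmean, probReal_univ, one_mul] at hlt
    exact absurd hlt (lt_irrefl _)

theorem map_mul_right_eq_self_of_mem_support {ν κ : Measure G} [IsProbabilityMeasure ν]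
    [IsProbabilityMeasure κ] (h : ν ∗ₘ κ = ν) {z : G} (hz : z ∈ κ.support) :
    ν.map (· * z) = ν := by
  have := Measure.isProbabilityMeasure_map (μ := ν) (measurable_mul_const z).aemeasurable
  refine ext_of_forall_integral_eq_of_IsFiniteMeasure fun φ => ?_
  rw [integral_map (measurable_mul_const z).aemeasurable φ.continuous.aestronglyMeasurable]
  let Λ : C(G, ℝ) := ⟨fun y => ∫ x, φ (x * y) ∂ν, by
    refine continuous_of_dominated (bound := fun _ => ‖φ‖) (fun y => ?_)
      (fun y => .of_forall fun x => φ.norm_coe_le_norm _) (integrable_const _)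
      (.of_forall fun x => by fun_prop)
    exact (by fun_prop : Continuous fun x => φ (x * y)).aestronglyMeasurable⟩
  have hΛ : ∀ y, ∫ z, Λ (z * y) ∂κ = Λ y := fun y => by
    have hφ : Continuous fun x => φ (x * y) := by fun_prop
    calc ∫ z, ∫ x, φ (x * (z * y)) ∂ν ∂κ = ∫ x, φ (x * y) ∂(ν ∗ₘ κ) := by
          rw [integral_mconv (.of_bound hφ.aestronglyMeasurable ‖φ‖
            (.of_forall fun x => φ.norm_coe_le_norm _))]
          simp only [mul_assoc]
          refine integral_integral_swap (.of_bound (Continuous.aestronglyMeasurable ?_) ‖φ‖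
            (.of_forall fun p => φ.norm_coe_le_norm _))
          fun_prop
      _ = Λ y := by rw [h]; rfl
  have hclosed : IsClosed {z | ∀ y, Λ (z * y) = Λ y} := by
    simp only [Set.ofPred_forall]
    exact isClosed_iInter fun y => isClosed_eq (by fun_prop) continuous_const
  have hzΛ := Measure.support_subset_of_isClosed hclosed
    (ae_mul_left_eq_of_forall_integral_eq hΛ) hz 1
  simpa [Λ] using hzΛ

end ChoquetDeny

section RightStabilizer

variable {ι : Type*}

/-- The subgroup of those elements whose right translations leave every measure of a family
invariant. For the marginals of a solution this is the subgroup `H` of the theorem. -/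
def rightStabilizer {G : Type*} [Group G] [MeasurableSpace G] [MeasurableMul G]
    (ν : ι → Measure G) : Subgroup G where
  carrier := {h | ∀ i, (ν i).map (· * h) = ν i}
  mul_mem' {a b} ha hb i := by
    have h := (Measure.map_map (μ := ν i) (measurable_mul_const b) (measurable_mul_const a)).symm
    rw [ha i, hb i] at h
    simpa only [Function.comp_def, mul_assoc] using h
  one_mem' i := by simp
  inv_mem' {a} ha i := by
    have h := Measure.map_map (μ := ν i) (measurable_mul_const a⁻¹) (measurable_mul_const a)
    rw [ha i] at h
    simpa [Function.comp_def] using h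

theorem mem_rightStabilizer {G : Type*} [Group G] [MeasurableSpace G] [MeasurableMul G]
    {ν : ι → Measure G} {h : G} : h ∈ rightStabilizer ν ↔ ∀ i, (ν i).map (· * h) = ν i := Iff.rfl

theorem rightStabilizer_map_mul_right {G : Type*} [Group G] [MeasurableSpace G] [MeasurableMul G]
    (ν : ι → Measure G) (g : G) : rightStabilizer (fun i => (ν i).map (· * g))
      = (rightStabilizer ν).map (MulAut.conj g⁻¹).toMonoidHom := by
  ext x
  have hx : x ∈ (rightStabilizer ν).map (MulAut.conj g⁻¹).toMonoidHom
      ↔ g * x * g⁻¹ ∈ rightStabilizer ν := by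
    rw [Subgroup.mem_map_equiv, map_inv, MulAut.inv_symm, MulAut.conj_apply]
  simp only [hx, mem_rightStabilizer]
  refine forall_congr' fun i => ?_
  have hcomm : ((ν i).map (· * g)).map (· * x) = ((ν i).map (· * (g * x * g⁻¹))).map (· * g) := by
    rw [Measure.map_map (measurable_mul_const x) (measurable_mul_const g),
      Measure.map_map (measurable_mul_const g) (measurable_mul_const _)]
    simp only [Function.comp_def, mul_assoc, inv_mul_cancel, mul_one]
  rw [hcomm]
  exact (MeasurableEquiv.mulRight g).map_measurableEquiv_injective.eq_iff

variable {G : Type*} [Group G] [TopologicalSpace G] [IsTopologicalGroup G]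
  [SecondCountableTopology G] [MeasurableSpace G] [BorelSpace G]

theorem map_mul_right_eq_self_of_tendsto {γ : Type*} {L : Filter γ} [L.NeBot]
    {κ : γ → ProbabilityMeasure G} {κ₀ : ProbabilityMeasure G} (h : Tendsto κ L (𝓝 κ₀)) {g : G}
    (hg : ∀ m, (κ m : Measure G).map (· * g) = κ m) : (κ₀ : Measure G).map (· * g) = κ₀ := by
  simp only [← conv_diracProba_eq_self_iff] at hg ⊢
  have hcl : IsClosed {ν : ProbabilityMeasure G | conv ν (diracProba g) = ν} :=
    isClosed_eq (continuous_conv.comp (continuous_id.prodMk continuous_const)) continuous_id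
  exact hcl.mem_of_tendsto h (.of_forall hg)

theorem isClosed_rightStabilizer (ν : ι → Measure G) [∀ i, IsProbabilityMeasure (ν i)] :
    IsClosed (rightStabilizer ν : Set G) := by
  have hset : (rightStabilizer ν : Set G) = ⋂ i, {h | conv ⟨ν i, inferInstance⟩ (diracProba h)
      = ⟨ν i, inferInstance⟩} := by
    ext h
    simp only [SetLike.mem_coe, mem_rightStabilizer, Set.mem_iInter, Set.mem_ofPred_eq]
    exact forall_congr' fun i =>
      (conv_diracProba_eq_self_iff (ν := ⟨ν i, inferInstance⟩) (g := h)).symm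
  rw [hset]
  exact isClosed_iInter fun i => isClosed_eq
    (continuous_conv.comp (continuous_const.prodMk continuous_diracProba)) continuous_const

end RightStabilizer

section Uniform

variable {G : Type*} [Group G] [TopologicalSpace G] [IsTopologicalGroup G] [MeasurableSpace G]
  [BorelSpace G] (H : Subgroup G) [CompactSpace H]

instance : IsProbabilityMeasure ((uniform H).map ((↑) : H → G)) :=
  Measure.isProbabilityMeasure_map measurable_subtype_coe.aemeasurable

theorem map_mul_left_map_uniform {x : G} (hx : x ∈ H) :
    ((uniform H).map ((↑) : H → G)).map (x * ·) = (uniform H).map ((↑) : H → G) := by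
  have hB : BorelSpace H := Subtype.borelSpace (H : Set G)
  have hleft : (uniform H).IsMulLeftInvariant := by
    unfold uniform
    infer_instance
  conv_rhs => rw [← map_mul_left_eq_self (uniform H) ⟨x, hx⟩]
  rw [Measure.map_map (measurable_const_mul x) measurable_subtype_coe,
    Measure.map_map measurable_subtype_coe (measurable_const_mul _)]
  rfl

theorem ae_mem_map_uniform [T2Space G] : ∀ᵐ x ∂(uniform H).map ((↑) : H → G), x ∈ H := by
  refine (ae_map_iff measurable_subtype_coe.aemeasurable ?_).2 (.of_forall Subtype.prop)
  exact (isCompact_iff_compactSpace.2 ‹CompactSpace H›).isClosed.measurableSet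

theorem eq_map_uniform [T2Space G] [SecondCountableTopology G] {κ : Measure G}
    [IsProbabilityMeasure κ] (hκ : ∀ᵐ z ∂κ, z ∈ H) (hinv : ∀ h ∈ H, κ.map (· * h) = κ) :
    κ = (uniform H).map ((↑) : H → G) := by
  have hleft : κ ∗ₘ (uniform H).map ((↑) : H → G) = κ :=
    mconv_eq_left_of_ae ((ae_mem_map_uniform H).mono hinv)
  exact hleft.symm.trans <| mconv_eq_right_of_ae (hκ.mono fun z hz => map_mul_left_map_uniform H hz)

theorem mem_of_map_uniform_eq [T2Space G] {g : G}
    (hg : ((uniform H).map ((↑) : H → G)).map (· * g) = (uniform H).map ((↑) : H → G)) :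
    g ∈ H := by
  have hmem := ae_mem_map_uniform H
  rw [← hg] at hmem
  obtain ⟨x, hxg, hx⟩ := ((ae_of_ae_map (measurable_mul_const g).aemeasurable hmem).and
    (ae_mem_map_uniform H)).exists
  exact (H.mul_mem_cancel_left hx).1 hxg

end Uniform

section Law

variable {Ω E : Type*} [MeasurableSpace Ω] [MeasurableSpace E] (P : Measure Ω)
  [IsProbabilityMeasure P]

/-- The law of a random variable as an element of the space of probability measures, in which
convergence in law is convergence in the usual sense. -/
noncomputable def law {X : Ω → E} (hX : AEMeasurable X P) : ProbabilityMeasure E :=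
  ⟨P.map X, Measure.isProbabilityMeasure_map hX⟩

theorem toMeasure_law {X : Ω → E} (hX : AEMeasurable X P) :
    (law P hX : Measure E) = P.map X := rfl

theorem law_eq_conv_of_indepFun [Monoid E] [MeasurableMul₂ E] {X Y Z : Ω → E}
    (hX : Measurable X) (hY : Measurable Y) (hZ : AEMeasurable Z P)
    (h : IndepFun X Y P) (hZXY : Z =ᵐ[P] X * Y) :
    law P hZ = conv (law P hX.aemeasurable) (law P hY.aemeasurable) := by
  refine ProbabilityMeasure.toMeasure_injective ?_
  rw [toMeasure_law, Measure.map_congr hZXY, h.map_mul_eq_map_mconv_map hX hY]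
  rfl

end Law

theorem tendsto_uniform_of_eventually_conv_eq {G : Type*} [Group G] [TopologicalSpace G]
    [IsTopologicalGroup G] [CompactSpace G] [T2Space G] [SecondCountableTopology G]
    [MeasurableSpace G] [BorelSpace G] {ι γ : Type*} {L : Filter γ}
    {ν : ι → ProbabilityMeasure G} {W : ι → γ → ProbabilityMeasure G}
    {κ : γ → ProbabilityMeasure G} {H : Subgroup G} [CompactSpace H]
    (hH : H = rightStabilizer fun i => (ν i : Measure G)) (hW : ∀ i, Tendsto (W i) L (𝓝 (ν i)))
    (hconv : ∀ i, ∀ᶠ m in L, conv (W i m) (κ m) = ν i)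
    (hinv : ∀ m, ∀ h ∈ H, (κ m : Measure G).map (· * h) = κ m) :
    Tendsto κ L (𝓝 ⟨(uniform H).map ((↑) : H → G), inferInstance⟩) := by
  refine tendsto_nhds_of_unique_mapClusterPt fun κ₀ hκ₀ => ?_
  obtain ⟨U, hU, hUκ⟩ := mapClusterPt_iff_ultrafilter.1 hκ₀
  have hfix : ∀ i, (ν i : Measure G) ∗ₘ (κ₀ : Measure G) = ν i := fun i => by
    rw [← toMeasure_conv, tendsto_nhds_unique_of_eventuallyEq
      (continuous_conv.tendsto (ν i, κ₀) |>.comp (((hW i).mono_left hU).prodMk_nhds hUκ))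
      tendsto_const_nhds (hU (hconv i))]
  refine ProbabilityMeasure.toMeasure_injective (eq_map_uniform H ?_ fun h hh =>
    map_mul_right_eq_self_of_tendsto hUκ fun m => hinv m h hh)
  filter_upwards [Measure.support_mem_ae (μ := (κ₀ : Measure G))] with z hz
  rw [hH]
  exact fun i => map_mul_right_eq_self_of_mem_support (hfix i) hz

section Paths

variable {E Ω : Type*}

/-- The path of a process up to the time with index `n`, shifted so that it starts at index `0`. -/
def pastPath (η : ℕ → Ω → E) (n : ℕ) (ω : Ω) : ℕ → E := fun i => η (n + i) ω

variable [MeasurableSpace E]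

theorem past_eq_comap (η : ℕ → Ω → E) (n : ℕ) :
    past η n = MeasurableSpace.comap (pastPath η n) inferInstance := by
  have hcomap : MeasurableSpace.comap (pastPath η n) MeasurableSpace.pi
      = ⨆ i, MeasurableSpace.comap (η (n + i)) inferInstance := by
    simp only [MeasurableSpace.pi, MeasurableSpace.comap_iSup, MeasurableSpace.comap_comp]
    rfl
  rw [hcomap]
  refine le_antisymm (iSup₂_le fun m hm => ?_)
    (iSup_le fun i => le_iSup₂_of_le (n + i) (Nat.le_add_right n i) le_rfl)
  obtain ⟨i, rfl⟩ := Nat.exists_eq_add_of_le hm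
  exact le_iSup (fun i => MeasurableSpace.comap (η (n + i)) inferInstance) i

theorem past_antitone (η : ℕ → Ω → E) : Antitone (past η) := fun _ _ hab =>
  iSup₂_le fun m hm => le_iSup₂_of_le m (hab.trans hm) le_rfl

variable {mΩ : MeasurableSpace Ω} {η : ℕ → Ω → E}

theorem measurable_pastPath (hη : ∀ n, Measurable (η n)) (n : ℕ) : Measurable (pastPath η n) :=
  measurable_pi_lambda _ fun i => hη (n + i)

theorem past_le (hη : ∀ n, Measurable (η n)) (n : ℕ) : past η n ≤ mΩ :=
  iSup₂_le fun m _ => (hη m).comap_le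

theorem pathLaw_eq_map_pastPath (P : Measure Ω) (η : ℕ → Ω → E) :
    pathLaw P η = P.map (pastPath η 0) :=
  congrArg (Measure.map · P) <| funext fun ω => funext fun i => congrArg (η · ω) (zero_add i).symm

end Paths

section Truncate

variable {E : Type*} [One E]

/-- The sequence with all entries after the index `m` replaced by `1`. The truncations of a process
encode its finite windows without a dependent index type. -/
def truncate (m : ℕ) (x : ℕ → E) : ℕ → E := fun i => if i ≤ m then x i else 1

theorem truncate_apply_of_le {i m : ℕ} (h : i ≤ m) (x : ℕ → E) : truncate m x i = x i := if_pos h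

theorem truncate_truncate {a b : ℕ} (hab : a ≤ b) (x : ℕ → E) :
    truncate a (truncate b x) = truncate a x := by
  ext i
  by_cases hi : i ≤ a
  · simp only [truncate, if_pos hi, if_pos (hi.trans hab)]
  · simp only [truncate, if_neg hi]

theorem truncate_zero (x : ℕ → E) : truncate 0 x = Function.update (1 : ℕ → E) 0 (x 0) := by
  ext i
  rcases eq_or_ne i 0 with rfl | hi
  · simp [truncate]
  · simp [truncate, hi]

theorem truncate_succ (m : ℕ) (x : ℕ → E) :
    truncate (m + 1) x = Function.update (truncate m x) (m + 1) (x (m + 1)) := by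
  ext i
  rcases eq_or_ne i (m + 1) with rfl | hi
  · simp [truncate]
  · simp [truncate, hi, Nat.le_succ_iff]

variable [MeasurableSpace E]

theorem measurable_truncate (m : ℕ) : Measurable (truncate m : (ℕ → E) → ℕ → E) := by
  refine measurable_pi_lambda _ fun i => ?_
  by_cases hi : i ≤ m
  · simpa only [truncate, if_pos hi] using measurable_pi_apply i
  · simpa only [truncate, if_neg hi] using measurable_const

theorem measurable_truncate_process {Ω : Type*} [MeasurableSpace Ω] {ξ : ℕ → Ω → E}
    (hξ : ∀ n, Measurable (ξ n)) (m : ℕ) : Measurable fun ω => truncate m (ξ · ω) :=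
  (measurable_truncate m).comp (measurable_pi_lambda _ hξ)

theorem measure_eq_of_forall_map_truncate_eq {Q Q' : Measure (ℕ → E)} [IsFiniteMeasure Q']
    (h : ∀ N, Q.map (truncate N) = Q'.map (truncate N)) : Q = Q' := by
  refine IsProjectiveLimit.unique (P := fun I => Q'.map I.restrict) (fun I => ?_) fun I => rfl
  have hI : (I.restrict : (ℕ → E) → I → E) = I.restrict ∘ truncate (I.sup id) := by
    ext x i
    exact (truncate_apply_of_le (Finset.le_sup (f := id) i.2) x).symm
  rw [hI, ← Measure.map_map (Finset.measurable_restrict I) (measurable_truncate _), h,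
    Measure.map_map (Finset.measurable_restrict I) (measurable_truncate _), ← hI]

/-- The filtration obtained by revealing the noise backwards in time: at the index `m` it is
generated by `ξ 0, …, ξ m`. -/
def noiseFiltration {Ω : Type*} {mΩ : MeasurableSpace Ω} {ξ : ℕ → Ω → E}
    (hξ : ∀ n, Measurable (ξ n)) : Filtration ℕ mΩ where
  seq m := MeasurableSpace.comap (fun ω => truncate m (ξ · ω)) inferInstance
  mono' a b hab := by
    have hab' : (fun ω => truncate a (ξ · ω)) = truncate a ∘ fun ω => truncate b (ξ · ω) :=
      funext fun ω => (truncate_truncate hab _).symm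
    dsimp only
    rw [hab', ← MeasurableSpace.comap_comp]
    exact MeasurableSpace.comap_mono (measurable_truncate a).comap_le
  le' m := (measurable_truncate_process hξ m).comap_le

end Truncate

section NoiseProd

variable {G Ω : Type*} [Group G]

theorem noiseProd_truncate (n m : ℕ) (x : ℕ → G) :
    noiseProd (fun i (x : ℕ → G) => x i) n m (truncate m x) = noiseProd (fun i x => x i) n m x := by
  unfold noiseProd
  congr 1
  refine List.map_congr_left fun i hi => truncate_apply_of_le ?_ x
  exact Nat.lt_succ_iff.1 (List.Ico.mem.1 hi).2

theorem noiseProd_self (ξ : ℕ → Ω → G) (n : ℕ) (ω : Ω) : noiseProd ξ n n ω = ξ n ω := by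
  simp [noiseProd]

theorem noiseProd_succ (ξ : ℕ → Ω → G) {n m : ℕ} (hnm : n ≤ m) (ω : Ω) :
    noiseProd ξ n (m + 1) ω = noiseProd ξ n m ω * ξ (m + 1) ω := by
  simp [noiseProd, List.Ico.succ_top (hnm.trans (Nat.le_succ m))]

theorem measurable_noiseProd [MeasurableSpace G] [MeasurableMul₂ G] [MeasurableSpace Ω]
    {ξ : ℕ → Ω → G} (hξ : ∀ n, Measurable (ξ n)) (n m : ℕ) : Measurable (noiseProd ξ n m) := by
  have := List.measurable_fun_prod ((List.Ico n (m + 1)).map ξ) fun f hf => by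
    obtain ⟨i, -, rfl⟩ := List.mem_map.1 hf
    exact hξ i
  simp only [List.map_map, Function.comp_def] at this
  exact this

end NoiseProd

section Solutions

variable {G : Type*} [Group G] [MeasurableSpace G] {μ : ℕ → ProbabilityMeasure G}
  {Ω : Type*} [MeasurableSpace Ω] {P : Measure Ω} {η ξ : ℕ → Ω → G}

theorem IsSolution.indepFun_noise_pastPath (h : IsSolution μ P η ξ) (n : ℕ) :
    IndepFun (ξ n) (pastPath η (n + 1)) P := by
  rw [IndepFun_iff_Indep, ← past_eq_comap]
  exact h.indep n

theorem IsSolution.ae_eq_noiseProd_mul (h : IsSolution μ P η ξ) {n m : ℕ} (hnm : n ≤ m) :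
    ∀ᵐ ω ∂P, η n ω = noiseProd ξ n m ω * η (m + 1) ω := by
  induction m, hnm using Nat.le_induction with
  | base => simpa only [noiseProd_self] using h.equation n
  | succ m hnm ih =>
    filter_upwards [ih, h.equation (m + 1)] with ω h1 h2
    rw [h1, h2, noiseProd_succ ξ hnm, mul_assoc]

theorem IsSolution.mul_right [MeasurableMul G] (h : IsSolution μ P η ξ) (g : G) :
    IsSolution μ P (fun n ω => η n ω * g) ξ where
  measurable_eta n := (h.measurable_eta n).mul_const g
  measurable_xi := h.measurable_xi
  equation n := by
    filter_upwards [h.equation n] with ω hω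
    rw [hω, mul_assoc]
  indep n := by
    refine indep_of_indep_of_le_right (h.indep n) (iSup₂_mono fun m _ => ?_)
    exact ((measurable_mul_const g).comp (comap_measurable (η m))).comap_le
  noise_law := h.noise_law

section Noise

variable [MeasurableMul₂ G] [MeasurableInv G] [IsProbabilityMeasure P]

theorem IsSolution.indepFun_truncate_noise_pastPath (h : IsSolution μ P η ξ) (m : ℕ) :
    IndepFun (fun ω => truncate m (ξ · ω)) (pastPath η (m + 1)) P := by
  induction m with
  | zero =>
    simp only [truncate_zero]
    exact (h.indepFun_noise_pastPath 0).comp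
      (measurable_update (1 : ℕ → G)) measurable_id
  | succ m ih =>
    let T : (ℕ → G) → G × (ℕ → G) := fun x => (x 0 * (x 1)⁻¹, fun i => x (i + 1))
    have hT : Measurable T := by fun_prop
    have hnext : IndepFun (fun ω => truncate m (ξ · ω))
        (fun ω => (ξ (m + 1) ω, pastPath η (m + 1 + 1) ω)) P := by
      refine (ih.comp measurable_id hT).congr .rfl ?_
      filter_upwards [h.equation (m + 1)] with ω hω
      refine Prod.ext (mul_inv_eq_of_eq_mul hω) (funext fun i => ?_)
      simp only [T, pastPath, Function.comp_apply, add_assoc, add_comm 1]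
    have hpair := indepFun_prodMk_left
      (measurable_truncate_process h.measurable_xi m)
      (h.measurable_xi (m + 1)) (measurable_pastPath h.measurable_eta _) hnext
      (h.indepFun_noise_pastPath (m + 1))
    simp only [truncate_succ]
    exact hpair.comp (φ := fun p => Function.update p.1 (m + 1) p.2) measurable_update'
      measurable_id

theorem IsSolution.indepFun_truncate_noise (h : IsSolution μ P η ξ) (m : ℕ) :
    IndepFun (fun ω => truncate m (ξ · ω)) (ξ (m + 1)) P := by
  have hT : Measurable fun x : ℕ → G => x 0 * (x 1)⁻¹ := by fun_prop
  refine ((h.indepFun_truncate_noise_pastPath m).comp measurable_id hT).congr .rfl ?_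
  filter_upwards [h.equation (m + 1)] with ω hω
  exact mul_inv_eq_of_eq_mul hω

theorem IsSolution.indepFun_noiseProd_pastPath (h : IsSolution μ P η ξ) (n m : ℕ) :
    IndepFun (noiseProd ξ n m) (pastPath η (m + 1)) P := by
  have := (h.indepFun_truncate_noise_pastPath m).comp
    (measurable_noiseProd (ξ := fun i (x : ℕ → G) => x i) measurable_pi_apply n m)
    measurable_id
  simp only [Function.comp_def, noiseProd_truncate] at this
  exact this

theorem IsSolution.map_truncate_noise_succ (h : IsSolution μ P η ξ) (m : ℕ) :
    P.map (fun ω => truncate (m + 1) (ξ · ω))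
      = ((P.map fun ω => truncate m (ξ · ω)).prod (μ (m + 1))).map
        fun p => Function.update p.1 (m + 1) p.2 := by
  have hmeas := measurable_truncate_process h.measurable_xi m
  rw [← h.noise_law, ← (indepFun_iff_map_prod_eq_prod_map_map hmeas.aemeasurable
    (h.measurable_xi _).aemeasurable).1 (h.indepFun_truncate_noise m),
    Measure.map_map measurable_update' (hmeas.prodMk (h.measurable_xi _))]
  simp only [truncate_succ]
  rfl

theorem IsSolution.map_truncate_eq (h : IsSolution μ P η ξ) (N : ℕ) :
    P.map (fun ω => truncate N (η · ω))
      = ((P.map fun ω => truncate N (ξ · ω)).prod (P.map (η (N + 1)))).map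
        fun p => truncate N fun n => noiseProd (fun i (x : ℕ → G) => x i) n N p.1 * p.2 := by
  have hmeas := measurable_truncate_process h.measurable_xi N
  have hind : IndepFun (fun ω => truncate N (ξ · ω)) (η (N + 1)) P :=
    (h.indepFun_truncate_noise_pastPath N).comp measurable_id (measurable_pi_apply 0)
  have hrec : Measurable fun p : (ℕ → G) × G =>
      truncate N fun n => noiseProd (fun i (x : ℕ → G) => x i) n N p.1 * p.2 := by
    refine (measurable_truncate N).comp (measurable_pi_lambda _ fun n => ?_)
    exact ((measurable_noiseProd measurable_pi_apply n N).comp measurable_fst).mul measurable_snd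
  rw [← (indepFun_iff_map_prod_eq_prod_map_map hmeas.aemeasurable
    (h.measurable_eta _).aemeasurable).1 hind,
    Measure.map_map hrec (hmeas.prodMk (h.measurable_eta _))]
  have heq : ∀ᵐ ω ∂P, ∀ n ≤ N, η n ω = noiseProd ξ n N ω * η (N + 1) ω :=
    ae_all_iff.2 fun n => eventually_imp_distrib_left.2 fun hn => h.ae_eq_noiseProd_mul hn
  refine Measure.map_congr ?_
  filter_upwards [heq] with ω hω
  ext n
  by_cases hn : n ≤ N
  · simp only [Function.comp_apply, noiseProd_truncate, truncate, if_pos hn]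
    exact hω n hn
  · simp only [Function.comp_apply, truncate, if_neg hn]

variable {Ω' : Type*} [MeasurableSpace Ω'] {P' : Measure Ω'} [IsProbabilityMeasure P']
  {η' ξ' : ℕ → Ω' → G}

theorem IsSolution.map_truncate_noise_eq (h : IsSolution μ P η ξ) (h' : IsSolution μ P' η' ξ')
    (m : ℕ) : P.map (fun ω => truncate m (ξ · ω)) = P'.map (fun ω => truncate m (ξ' · ω)) := by
  induction m with
  | zero =>
    have hupd : Measurable fun x : G => Function.update (1 : ℕ → G) 0 x := measurable_update _
    simp only [truncate_zero]
    have hmap := congrArg (Measure.map fun x => Function.update (1 : ℕ → G) 0 x)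
      ((h.noise_law 0).trans (h'.noise_law 0).symm)
    rwa [Measure.map_map hupd (h.measurable_xi 0), Measure.map_map hupd (h'.measurable_xi 0)]
      at hmap
  | succ m ih => rw [h.map_truncate_noise_succ, h'.map_truncate_noise_succ, ih]

theorem IsSolution.map_noiseProd_eq (h : IsSolution μ P η ξ) (h' : IsSolution μ P' η' ξ')
    (n m : ℕ) : P.map (noiseProd ξ n m) = P'.map (noiseProd ξ' n m) := by
  have hprod := measurable_noiseProd (ξ := fun i (x : ℕ → G) => x i) measurable_pi_apply n m
  have := congrArg (Measure.map (noiseProd (fun i (x : ℕ → G) => x i) n m))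
    (h.map_truncate_noise_eq h' m)
  rw [Measure.map_map hprod (measurable_truncate_process h.measurable_xi m),
    Measure.map_map hprod (measurable_truncate_process h'.measurable_xi m)] at this
  simp only [Function.comp_def, noiseProd_truncate] at this
  exact this

theorem IsSolution.pathLaw_eq_of_map_eq (h : IsSolution μ P η ξ) (h' : IsSolution μ P' η' ξ')
    (heq : ∀ n, P.map (η n) = P'.map (η' n)) : pathLaw P η = pathLaw P' η' := by
  have hpath : Measurable fun ω n => η n ω := measurable_pi_lambda _ h.measurable_eta
  have hpath' : Measurable fun ω n => η' n ω := measurable_pi_lambda _ h'.measurable_eta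
  have := Measure.isProbabilityMeasure_map (μ := P') hpath'.aemeasurable
  refine measure_eq_of_forall_map_truncate_eq (Q' := P'.map fun ω n => η' n ω) fun N => ?_
  rw [pathLaw, Measure.map_map (measurable_truncate N) hpath,
    Measure.map_map (measurable_truncate N) hpath']
  simp only [Function.comp_def]
  rw [h.map_truncate_eq, h'.map_truncate_eq, h.map_truncate_noise_eq h', heq]

end Noise

section RemotePast

theorem IsSolution.cond [IsProbabilityMeasure P] (h : IsSolution μ P η ξ) {A : Set Ω}
    (hA : ∀ n, MeasurableSet[past η n] A) (hA0 : P A ≠ 0) : IsSolution μ (P[|A]) η ξ := by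
  have hAm : MeasurableSet A := past_le h.measurable_eta 0 _ (hA 0)
  have hprob : IsProbabilityMeasure (P[|A]) := cond_isProbabilityMeasure hA0
  have hinter : ∀ n s t, MeasurableSet[MeasurableSpace.comap (ξ n) inferInstance] s →
      MeasurableSet[past η (n + 1)] t → P[s ∩ t | A] = P s * P[t | A] := fun n s t hs ht => by
    rw [cond_apply hAm, cond_apply hAm, Set.inter_left_comm,
      (Indep_iff _ _ _).1 (h.indep n) s (A ∩ t) hs ((hA (n + 1)).inter ht), mul_left_comm]
  have hnoise : ∀ n s, MeasurableSet[MeasurableSpace.comap (ξ n) inferInstance] s →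
      P[s | A] = P s := fun n s hs => by
    simpa using hinter n s Set.univ hs MeasurableSet.univ
  refine ⟨h.measurable_eta, h.measurable_xi, fun n => ?_, fun n => ?_, fun n => ?_⟩
  · exact cond_absolutelyContinuous.ae_le (h.equation n)
  · refine (Indep_iff _ _ _).2 fun s t hs ht => ?_
    rw [hinter n s t hs ht, hnoise n s hs]
  · rw [← h.noise_law n]
    ext s hs
    rw [Measure.map_apply (h.measurable_xi n) hs, Measure.map_apply (h.measurable_xi n) hs]
    exact hnoise n _ ⟨s, hs, rfl⟩

theorem mem_openSegment_cond_compl [IsProbabilityMeasure P] {A : Set Ω} (hA : MeasurableSet A)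
    (h0 : P A ≠ 0) (h0' : P Aᶜ ≠ 0) : P ∈ openSegment ℝ≥0 (P[|A]) (P[|Aᶜ]) := by
  refine ⟨(P A).toNNReal, (P Aᶜ).toNNReal, ENNReal.toNNReal_pos h0 (measure_ne_top _ _),
    ENNReal.toNNReal_pos h0' (measure_ne_top _ _), ?_, ?_⟩
  · rw [← ENNReal.toNNReal_add (measure_ne_top _ _) (measure_ne_top _ _),
      prob_add_prob_compl hA, ENNReal.toNNReal_one]
  · ext s
    rw [← cond_add_cond_compl_eq hA (μ := P) (t := s), Measure.add_apply, Measure.smul_apply,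
      Measure.smul_apply, ENNReal.smul_def, ENNReal.smul_def,
      ENNReal.coe_toNNReal (measure_ne_top _ _), ENNReal.coe_toNNReal (measure_ne_top _ _),
      smul_eq_mul, smul_eq_mul, mul_comm, mul_comm (P Aᶜ)]

theorem pathLaw_mem_openSegment {E : Type*} [MeasurableSpace E] {ζ : ℕ → Ω → E}
    (hζ : ∀ n, Measurable (ζ n)) {P₁ P₂ : Measure Ω} (h : P ∈ openSegment ℝ≥0 P₁ P₂) :
    pathLaw P ζ ∈ openSegment ℝ≥0 (pathLaw P₁ ζ) (pathLaw P₂ ζ) := by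
  obtain ⟨a, b, ha, hb, hab, rfl⟩ := h
  refine ⟨a, b, ha, hb, hab, ?_⟩
  simp only [pathLaw, Measure.map_add _ _ (measurable_pi_lambda _ hζ), Measure.map_smul]

theorem IsExtremalSolution.measure_eq_zero_or_one [TopologicalSpace G] [IsTopologicalGroup G]
    [SecondCountableTopology G] [BorelSpace G] [T2Space G] [IsProbabilityMeasure P]
    (h : IsExtremalSolution μ P η ξ) {A : Set Ω} (hA : MeasurableSet[⨅ n, past η n] A) :
    P A = 0 ∨ P A = 1 := by
  rw [MeasurableSpace.measurableSet_iInf] at hA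
  have hη := h.isSolution.measurable_eta
  have hAm : MeasurableSet A := past_le hη 0 _ (hA 0)
  refine or_iff_not_imp_left.2 fun h0 => ?_
  by_contra h1
  have h0' : P Aᶜ ≠ 0 := by rwa [Ne, prob_compl_eq_zero_iff hAm]
  have hprob : IsProbabilityMeasure (P[|A]) := cond_isProbabilityMeasure h0
  have hprob' : IsProbabilityMeasure (P[|Aᶜ]) := cond_isProbabilityMeasure h0'
  have heq : pathLaw (P[|A]) η = pathLaw P η :=
    (mem_extremePoints.1 h.extremal).2 _ (h.isSolution.cond hA h0).pathLaw_mem _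
      (h.isSolution.cond (fun n => (hA n).compl) h0').pathLaw_mem
      (pathLaw_mem_openSegment hη (mem_openSegment_cond_compl hAm h0 h0')) |>.1
  have hA0 := hA 0
  rw [past_eq_comap] at hA0
  obtain ⟨B, hB, rfl⟩ := hA0
  have hval := congrArg (fun ρ => ρ B) heq
  simp only [pathLaw_eq_map_pastPath, Measure.map_apply (measurable_pastPath hη 0) hB] at hval
  exact h1 (hval.symm.trans (cond_apply_self h0 (measure_ne_top _ _)))

end RemotePast

end Solutions

section ConditionalExpectation

variable {G : Type*} [Group G] [MeasurableSpace G] [MeasurableMul₂ G] [MeasurableInv G]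
  {μ : ℕ → ProbabilityMeasure G} {Ω : Type*} [MeasurableSpace Ω] {P : Measure Ω}
  [IsProbabilityMeasure P] {η ξ : ℕ → Ω → G} {φ : G → ℝ} {n m : ℕ}

theorem IsSolution.condExp_past_ae_eq_integral (h : IsSolution μ P η ξ) (hφ : Measurable φ)
    {C : ℝ} (hC : ∀ x, ‖φ x‖ ≤ C) (hnm : n ≤ m) :
    P[fun ω => φ (η n ω) | past η (m + 1)] =ᵐ[P]
      fun ω => ∫ ω', φ (noiseProd ξ n m ω' * η (m + 1) ω) ∂P := by
  have hX := measurable_pastPath h.measurable_eta (m + 1)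
  have hY := measurable_noiseProd h.measurable_xi n m
  have := Measure.isProbabilityMeasure_map (μ := P) hX.aemeasurable
  have := Measure.isProbabilityMeasure_map (μ := P) hY.aemeasurable
  have hf : Measurable fun p : (ℕ → G) × G => φ (p.2 * p.1 0) := hφ.comp (by fun_prop)
  have hcongr : (fun ω => φ (η n ω)) =ᵐ[P] fun ω => φ (noiseProd ξ n m ω * η (m + 1) ω) := by
    filter_upwards [h.ae_eq_noiseProd_mul hnm] with ω hω
    rw [hω]
  rw [past_eq_comap]
  exact (condExp_congr_ae hcongr).trans <| condExp_comap_ae_eq_integral hX hY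
    (h.indepFun_noiseProd_pastPath n m).symm
    (.of_bound hf.aestronglyMeasurable C (.of_forall fun p => hC _))

theorem IsSolution.condExp_noiseFiltration_ae_eq_integral (h : IsSolution μ P η ξ)
    (hφ : Measurable φ) {C : ℝ} (hC : ∀ x, ‖φ x‖ ≤ C) (hnm : n ≤ m) :
    P[fun ω => φ (η n ω) | noiseFiltration h.measurable_xi m] =ᵐ[P]
      fun ω => ∫ ω', φ (noiseProd ξ n m ω * η (m + 1) ω') ∂P := by
  have hX := measurable_truncate_process h.measurable_xi m
  have := Measure.isProbabilityMeasure_map (μ := P) hX.aemeasurable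
  have := Measure.isProbabilityMeasure_map (μ := P) (h.measurable_eta (m + 1)).aemeasurable
  let f : (ℕ → G) × G → ℝ := fun p => φ (noiseProd (fun i (x : ℕ → G) => x i) n m p.1 * p.2)
  have hf : Measurable f :=
    hφ.comp (((measurable_noiseProd measurable_pi_apply n m).comp measurable_fst).mul
      measurable_snd)
  have hfξ : ∀ ω y, f (truncate m (ξ · ω), y) = φ (noiseProd ξ n m ω * y) := fun ω y => by
    simp only [f, noiseProd_truncate]
    rfl
  have hcongr : (fun ω => φ (η n ω)) =ᵐ[P] fun ω => f (truncate m (ξ · ω), η (m + 1) ω) := by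
    filter_upwards [h.ae_eq_noiseProd_mul hnm] with ω hω
    rw [hω, hfξ]
  refine (condExp_congr_ae hcongr).trans ?_
  simp only [← hfξ]
  exact condExp_comap_ae_eq_integral hX (h.measurable_eta (m + 1))
    ((h.indepFun_truncate_noise_pastPath m).comp measurable_id (measurable_pi_apply 0))
    (.of_bound hf.aestronglyMeasurable C (.of_forall fun p => hC _))

end ConditionalExpectation

theorem integrable_continuousMap_comp {X Ω : Type*} [TopologicalSpace X] [CompactSpace X]
    [MeasurableSpace X] [OpensMeasurableSpace X] [MeasurableSpace Ω] {P : Measure Ω}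
    [IsFiniteMeasure P] (φ : C(X, ℝ)) {Y : Ω → X} (hY : AEMeasurable Y P) :
    Integrable (fun ω => φ (Y ω)) P :=
  .of_bound (φ.continuous.measurable.comp_aemeasurable hY).aestronglyMeasurable ‖φ‖
    (.of_forall fun _ => φ.norm_coe_le_norm _)

section Distribution

variable {X : Type*} [TopologicalSpace X] [CompactSpace X] [MeasurableSpace X]
  [OpensMeasurableSpace X] {Ω Ω' : Type*} [MeasurableSpace Ω] [MeasurableSpace Ω']
  {P : Measure Ω} [IsProbabilityMeasure P] {P' : Measure Ω'} [IsProbabilityMeasure P']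
  {ι γ : Type*} {L : Filter γ} {Y : γ → Ω → X} {Z : Ω' → X}

theorem tendstoInDistribution_of_forall_dense_integral {φ : ι → C(X, ℝ)} (hφ : DenseRange φ)
    (hY : ∀ m, AEMeasurable (Y m) P) (hZ : AEMeasurable Z P')
    (h : ∀ i, Tendsto (fun m => ∫ ω, φ i (Y m ω) ∂P) L (𝓝 (∫ ω, φ i (Z ω) ∂P'))) :
    TendstoInDistribution Y L Z (fun _ => P) P' := by
  refine ⟨hY, hZ, tendsto_of_forall_dense_integral hφ fun i => ?_⟩
  have hφi {ν : Measure X} := (φ i).continuous.measurable.aestronglyMeasurable (μ := ν)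
  simpa only [ProbabilityMeasure.coe_mk, integral_map (hY _) hφi, integral_map hZ hφi] using h i

theorem tendsto_integral_of_tendstoInDistribution
    (h : TendstoInDistribution Y L Z (fun _ => P) P') (φ : C(X, ℝ)) :
    Tendsto (fun m => ∫ ω, φ (Y m ω) ∂P) L (𝓝 (∫ ω, φ (Z ω) ∂P')) := by
  have hφ {ν : Measure X} := φ.continuous.measurable.aestronglyMeasurable (μ := ν)
  simpa only [ProbabilityMeasure.coe_mk, BoundedContinuousFunction.mkOfCompact_apply,
    integral_map (h.forall_aemeasurable _) hφ, integral_map h.aemeasurable_limit hφ] using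
    ProbabilityMeasure.tendsto_iff_forall_integral_tendsto.1 h.tendsto (.mkOfCompact φ)

end Distribution

section Oscillation

variable {M : Type*} [Mul M] [TopologicalSpace M] [ContinuousMul M] [CompactSpace M]

/-- The uniform distance between `φ` and its right translate by `z`, as a function of `z`. -/
noncomputable def rightOscillation (φ : C(M, ℝ)) : C(M, ℝ) where
  toFun z := ‖ContinuousMap.curry ⟨fun p : M × M => φ (p.2 * p.1), by fun_prop⟩ z - φ‖

theorem norm_apply_mul_sub_le_rightOscillation (φ : C(M, ℝ)) (x z : M) :
    ‖φ (x * z) - φ x‖ ≤ rightOscillation φ z :=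
  (ContinuousMap.curry ⟨fun p : M × M => φ (p.2 * p.1), by fun_prop⟩ z - φ).norm_coe_le_norm x

theorem rightOscillation_eq_zero {φ : C(M, ℝ)} {z : M} (h : ∀ x, φ (x * z) = φ x) :
    rightOscillation φ z = 0 := by
  have hz : ContinuousMap.curry ⟨fun p : M × M => φ (p.2 * p.1), by fun_prop⟩ z = φ :=
    ContinuousMap.ext h
  simp only [rightOscillation, ContinuousMap.coe_mk, hz, sub_self, norm_zero]

theorem rightOscillation_nonneg (φ : C(M, ℝ)) (z : M) : 0 ≤ rightOscillation φ z :=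
  (norm_nonneg _).trans (norm_apply_mul_sub_le_rightOscillation φ z z)

end Oscillation

theorem tendsto_integral_rightOscillation {G : Type*} [Group G] [TopologicalSpace G]
    [IsTopologicalGroup G] [CompactSpace G] [MeasurableSpace G] [BorelSpace G] {H : Subgroup G}
    [CompactSpace H] {φ : C(G, ℝ)} (hφ : ∀ x, ∀ h ∈ H, φ (x * h) = φ x) {Ω γ : Type*}
    [MeasurableSpace Ω] {P : Measure Ω} [IsProbabilityMeasure P] {L : Filter γ} {X : γ → Ω → G}
    (hX : TendstoInDistribution X L (fun h : H => (h : G)) (fun _ => P) (uniform H)) :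
    Tendsto (fun m => ∫ ω, rightOscillation φ (X m ω) ∂P) L (𝓝 0) := by
  have hzero : ∀ z : H, rightOscillation φ z = 0 := fun z =>
    rightOscillation_eq_zero fun x => hφ x z z.2
  simpa only [hzero, integral_zero] using
    tendsto_integral_of_tendstoInDistribution hX (rightOscillation φ)

theorem map_const_mul_map_mul_right {M Ω : Type*} [Semigroup M] [MeasurableSpace M]
    [MeasurableMul M] [MeasurableSpace Ω] {P : Measure Ω} {X : Ω → M} (hX : Measurable X) {g : M}
    (hg : (P.map X).map (· * g) = P.map X) (a : M) :
    (P.map fun ω => a * X ω).map (· * g) = P.map fun ω => a * X ω := by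
  have hmap : (P.map fun ω => a * X ω) = (P.map X).map (a * ·) :=
    (Measure.map_map (measurable_const_mul a) hX).symm
  conv_rhs => rw [hmap, ← hg]
  rw [hmap, Measure.map_map (measurable_const_mul a) (measurable_mul_const g),
    Measure.map_map (measurable_mul_const g) (measurable_const_mul a)]
  simp only [Function.comp_def, mul_assoc]

section Convergence

variable {G : Type*} [Group G] [TopologicalSpace G] [IsTopologicalGroup G]
  [MeasurableSpace G] [BorelSpace G] {μ : ℕ → ProbabilityMeasure G} {Ω : Type*}
  [MeasurableSpace Ω] {P : Measure Ω} [IsProbabilityMeasure P] {η ξ : ℕ → Ω → G}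

theorem IsSolution.eLpNorm_noiseProd_sub_le [CompactSpace G] (h : IsSolution μ P η ξ)
    (φ : C(G, ℝ)) {n m : ℕ} (hnm : n ≤ m) (a : G) :
    eLpNorm ((fun ω => φ (noiseProd ξ n m ω * a)) - fun ω => φ (η n ω)) 1 P
      ≤ ENNReal.ofReal (∫ ω, rightOscillation φ (a⁻¹ * η (m + 1) ω) ∂P) := by
  rw [eLpNorm_one_eq_lintegral_enorm, ofReal_integral_eq_lintegral_ofReal
    (integrable_continuousMap_comp _ ((h.measurable_eta _).const_mul _).aemeasurable)
    (.of_forall fun _ => rightOscillation_nonneg _ _)]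
  refine lintegral_mono_ae ?_
  filter_upwards [h.ae_eq_noiseProd_mul hnm] with ω hω
  rw [Pi.sub_apply, ← ofReal_norm, norm_sub_rev, hω]
  refine ENNReal.ofReal_le_ofReal ?_
  simpa only [mul_assoc, mul_inv_cancel_left] using
    norm_apply_mul_sub_le_rightOscillation φ (noiseProd ξ n m ω * a) (a⁻¹ * η (m + 1) ω)

variable [SecondCountableTopology G]

section CompactGroup

variable [CompactSpace G]

section Translations

variable [T2Space G]

theorem IsExtremalSolution.tendsto_lintegral_noiseProd (h : IsExtremalSolution μ P η ξ)
    (φ : C(G, ℝ)) (n : ℕ) :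
    Tendsto (fun m => ∫⁻ ω, ‖∫ ω', φ (noiseProd ξ n m ω' * η (m + 1) ω) ∂P
      - ∫ ω', φ (η n ω') ∂P‖ₑ ∂P) atTop (𝓝 0) := by
  have hη := h.isSolution.measurable_eta
  have hX : MemLp (fun ω => φ (η n ω)) 2 P := .of_bound
    (φ.continuous.measurable.comp (hη n)).aestronglyMeasurable ‖φ‖
    (.of_forall fun ω => φ.norm_coe_le_norm _)
  refine ((tendsto_lintegral_condExp_of_trivial_iInf (past_antitone η) (past_le hη)
    (fun A hA => h.measure_eq_zero_or_one hA) hX).comp (tendsto_add_atTop_nat 1)).congr' ?_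
  filter_upwards [eventually_ge_atTop n] with m hm
  refine lintegral_congr_ae ?_
  filter_upwards [h.isSolution.condExp_past_ae_eq_integral φ.continuous.measurable
    φ.norm_coe_le_norm hm] with ω hω
  rw [hω]

theorem IsExtremalSolution.exists_tendstoInDistribution (h : IsExtremalSolution μ P η ξ) :
    ∃ α : ℕ → G, ∀ n, TendstoInDistribution (fun m ω => noiseProd ξ n m ω * α m) atTop (η n)
      (fun _ => P) P := by
  have hη := h.isSolution.measurable_eta
  have hξ := fun n m => measurable_noiseProd h.isSolution.measurable_xi n m
  let φ : ℕ → C(G, ℝ) := TopologicalSpace.denseSeq C(G, ℝ)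
  let f : ℕ → ℕ → Ω → ENNReal := fun i m ω =>
    ‖∫ ω', φ i.unpair.1 (noiseProd ξ i.unpair.2 m ω' * η (m + 1) ω) ∂P
      - ∫ ω', φ i.unpair.1 (η i.unpair.2 ω') ∂P‖ₑ
  have hf : ∀ i m, Measurable (f i m) := fun i m => by
    have hφ : StronglyMeasurable fun p : Ω × Ω =>
        φ i.unpair.1 (noiseProd ξ i.unpair.2 m p.2 * η (m + 1) p.1) :=
      (φ _).continuous.stronglyMeasurable.comp_measurable
        (((hξ _ m).comp measurable_snd).mul ((hη _).comp measurable_fst))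
    exact (hφ.integral_prod_right'.measurable.sub_const _).enorm
  obtain ⟨w, hw⟩ := exists_seq_forall_tendsto_zero hf
    fun i => h.tendsto_lintegral_noiseProd (φ i.unpair.1) i.unpair.2
  refine ⟨fun m => η (m + 1) (w m), fun n => ?_⟩
  refine tendstoInDistribution_of_forall_dense_integral (TopologicalSpace.denseRange_denseSeq _)
    (fun m => ((hξ n m).mul_const _).aemeasurable) (hη n).aemeasurable fun i => ?_
  rw [tendsto_iff_edist_tendsto_0]
  simpa only [f, Nat.unpair_pair, edist_eq_enorm_sub] using hw (Nat.pair i n)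

end Translations

theorem IsSolution.tendstoInDistribution_uniform [T2Space G] (h : IsSolution μ P η ξ) {α : ℕ → G}
    (hα : ∀ n, TendstoInDistribution (fun m ω => noiseProd ξ n m ω * α m) atTop (η n)
      (fun _ => P) P) {H : Subgroup G} [CompactSpace H]
    (hH : H = rightStabilizer fun n => P.map (η n)) :
    TendstoInDistribution (fun m ω => (α m)⁻¹ * η (m + 1) ω) atTop
      (fun h : H => (h : G)) (fun _ => P) (uniform H) := by
  have hη := h.measurable_eta
  have hX := fun m => (hη (m + 1)).const_mul (α m)⁻¹
  have hW := fun n m => (measurable_noiseProd h.measurable_xi n m).mul_const (α m)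
  refine ⟨fun m => (hX m).aemeasurable, measurable_subtype_coe.aemeasurable,
    tendsto_uniform_of_eventually_conv_eq (ν := fun n => law P (hη n).aemeasurable)
      (W := fun n m => law P (hW n m).aemeasurable) hH (fun n => (hα n).tendsto)
      (fun n => ?_) fun m g hg => ?_⟩
  · filter_upwards [eventually_ge_atTop n] with m hm
    refine (law_eq_conv_of_indepFun P (hW n m) (hX m) (hη n).aemeasurable ?_ ?_).symm
    · exact (h.indepFun_noiseProd_pastPath n m).comp (measurable_mul_const (α m))
        ((measurable_pi_apply 0).const_mul _)
    · filter_upwards [h.ae_eq_noiseProd_mul hm] with ω hω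
      rw [Pi.mul_apply, hω, mul_assoc, mul_inv_cancel_left]
  · rw [hH] at hg
    exact map_const_mul_map_mul_right (hη (m + 1)) (hg (m + 1)) _

section Cosets

variable {H : Subgroup G} [CompactSpace H]

theorem IsSolution.norm_condExp_noiseFiltration_sub_le (h : IsSolution μ P η ξ) (φ : C(G, ℝ))
    {n m : ℕ} (hnm : n ≤ m) (a : G) : ∀ᵐ ω ∂P,
    ‖(P[fun ω => φ (η n ω) | noiseFiltration h.measurable_xi m]) ω - φ (noiseProd ξ n m ω * a)‖
      ≤ ∫ ω', rightOscillation φ (a⁻¹ * η (m + 1) ω') ∂P := by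
  have hint := fun (ψ : C(G, ℝ)) (x : G) => integrable_continuousMap_comp ψ
    ((h.measurable_eta (m + 1)).const_mul x).aemeasurable (P := P)
  filter_upwards [h.condExp_noiseFiltration_ae_eq_integral φ.continuous.measurable
    φ.norm_coe_le_norm hnm] with ω hω
  have hsub : ∫ ω', φ (noiseProd ξ n m ω * η (m + 1) ω') ∂P - φ (noiseProd ξ n m ω * a)
      = ∫ ω', (φ (noiseProd ξ n m ω * η (m + 1) ω') - φ (noiseProd ξ n m ω * a)) ∂P := by
    rw [integral_sub (hint φ _) (integrable_const _), integral_const, probReal_univ, one_smul]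
  rw [hω, hsub]
  refine norm_integral_le_of_norm_le (hint _ _) (.of_forall fun ω' => ?_)
  simpa only [mul_assoc, mul_inv_cancel_left] using
    norm_apply_mul_sub_le_rightOscillation φ (noiseProd ξ n m ω * a) (a⁻¹ * η (m + 1) ω')

theorem IsSolution.ae_tendsto_apply_noiseProd (h : IsSolution μ P η ξ) {α : ℕ → G}
    (hα : TendstoInDistribution (fun m ω => (α m)⁻¹ * η (m + 1) ω) atTop
      (fun h : H => (h : G)) (fun _ => P) (uniform H)) {φ : C(G, ℝ)}
    (hφ : ∀ x, ∀ h ∈ H, φ (x * h) = φ x) (n : ℕ) :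
    ∀ᵐ ω ∂P, Tendsto (fun m => φ (noiseProd ξ n m ω * α m)) atTop (𝓝 (φ (η n ω))) := by
  let F := noiseFiltration h.measurable_xi
  have hε := tendsto_integral_rightOscillation hφ hα
  have hclose : ∀ᵐ ω ∂P, ∀ m, n ≤ m →
      ‖(P[fun ω => φ (η n ω) | F m]) ω - φ (noiseProd ξ n m ω * α m)‖
        ≤ ∫ ω', rightOscillation φ ((α m)⁻¹ * η (m + 1) ω') ∂P :=
    ae_all_iff.2 fun m => eventually_imp_distrib_left.2 fun hm =>
      h.norm_condExp_noiseFiltration_sub_le φ hm (α m)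
  have hconv : ∀ᵐ ω ∂P, Tendsto (fun m => φ (noiseProd ξ n m ω * α m)) atTop
      (𝓝 ((P[fun ω => φ (η n ω) | ⨆ m, F m]) ω)) := by
    filter_upwards [tendsto_ae_condExp (ℱ := F) (fun ω => φ (η n ω)), hclose] with ω hlevy hω
    have := squeeze_zero_norm' ((eventually_ge_atTop n).mono hω) hε
    simpa only [sub_sub_cancel, sub_zero] using hlevy.sub this
  have hmeas : ∀ m, AEStronglyMeasurable (fun ω => φ (noiseProd ξ n m ω * α m)) P := fun m =>
    (φ.continuous.measurable.comp
      ((measurable_noiseProd h.measurable_xi n m).mul_const _)).aestronglyMeasurable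
  have hL1 : Tendsto (fun m => eLpNorm ((fun ω => φ (noiseProd ξ n m ω * α m))
      - fun ω => φ (η n ω)) 1 P) atTop (𝓝 0) :=
    tendsto_of_tendsto_of_tendsto_of_le_of_le' tendsto_const_nhds
      (by simpa only [ENNReal.ofReal_zero] using ENNReal.tendsto_ofReal hε)
      (.of_forall fun _ => zero_le)
      ((eventually_ge_atTop n).mono fun m hm => h.eLpNorm_noiseProd_sub_le φ hm (α m))
  have hlim := tendstoInMeasure_ae_unique (tendstoInMeasure_of_tendsto_ae hmeas hconv)
    (tendstoInMeasure_of_tendsto_eLpNorm one_ne_zero hmeas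
      (φ.continuous.measurable.comp (h.measurable_eta n)).aestronglyMeasurable hL1)
  filter_upwards [hconv, hlim] with ω hω heq
  rw [heq] at hω
  exact hω

theorem IsSolution.ae_tendsto_mk [T2Space G] (h : IsSolution μ P η ξ) {α : ℕ → G}
    (hα : TendstoInDistribution (fun m ω => (α m)⁻¹ * η (m + 1) ω) atTop
      (fun h : H => (h : G)) (fun _ => P) (uniform H)) (n : ℕ) :
    ∀ᵐ ω ∂P, Tendsto (fun m => ((noiseProd ξ n m ω * α m : G) : G ⧸ H)) atTop
      (𝓝 ((η n ω : G) : G ⧸ H)) := by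
  have hcl : IsClosed (H : Set G) := (isCompact_iff_compactSpace.2 ‹CompactSpace H›).isClosed
  let φ : ℕ → C(G ⧸ H, ℝ) := TopologicalSpace.denseSeq C(G ⧸ H, ℝ)
  have hall := ae_all_iff.2 fun i => h.ae_tendsto_apply_noiseProd hα
    (φ := (φ i).comp ⟨QuotientGroup.mk, by fun_prop⟩)
    (fun x z hz => congrArg (φ i) (QuotientGroup.mk_mul_of_mem x hz)) n
  filter_upwards [hall] with ω hω
  exact tendsto_of_forall_dense_apply (TopologicalSpace.denseRange_denseSeq _) hω

end Cosets

theorem IsExtremalSolution.exists_conditions [T2Space G] (h : IsExtremalSolution μ P η ξ) :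
    ∃ (α : ℕ → G) (H : Subgroup G) (_ : CompactSpace H), Conditions P η ξ α H := by
  have hs := h.isSolution
  obtain ⟨α, hα⟩ := h.exists_tendstoInDistribution
  have hprob : ∀ n, IsProbabilityMeasure (P.map (η n)) := fun n =>
    Measure.isProbabilityMeasure_map (hs.measurable_eta n).aemeasurable
  have hcompact : CompactSpace (rightStabilizer fun n => P.map (η n)) :=
    isCompact_iff_compactSpace.1 (isClosed_rightStabilizer fun n => P.map (η n)).isCompact
  have hE2 := hs.tendstoInDistribution_uniform hα rfl
  refine ⟨α, rightStabilizer fun n => P.map (η n), hcompact, hα, hE2, fun g hg => ?_,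
    hs.ae_tendsto_mk hE2⟩
  refine (hs.mul_right g).pathLaw_eq_of_map_eq hs fun n => ?_
  exact (Measure.map_map (measurable_mul_const g) (hs.measurable_eta n)).symm.trans (hg n)

end CompactGroup

section Uniqueness

theorem Conditions.eq_rightStabilizer [T2Space G] {α : ℕ → G} {H : Subgroup G}
    [CompactSpace H] (hc : Conditions P η ξ α H) (hη : ∀ n, Measurable (η n)) :
    H = rightStabilizer fun n => P.map (η n) := by
  refine le_antisymm (fun g hg n => ?_) fun g hg => ?_
  · have hmarg := congrArg (Measure.map fun x : ℕ → G => x n) (hc.E3 g hg)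
    rw [pathLaw, pathLaw,
      Measure.map_map (measurable_pi_apply n) (measurable_pi_lambda _ fun n => (hη n).mul_const g),
      Measure.map_map (measurable_pi_apply n) (measurable_pi_lambda _ hη)] at hmarg
    exact (Measure.map_map (measurable_mul_const g) (hη n)).trans hmarg
  · exact mem_of_map_uniform_eq H <| map_mul_right_eq_self_of_tendsto hc.E2.tendsto
      fun m => map_const_mul_map_mul_right (hη _) (hg (m + 1)) _

variable {Ω' : Type*} [MeasurableSpace Ω'] {P' : Measure Ω'} [IsProbabilityMeasure P']
  {η' ξ' : ℕ → Ω' → G} {α α' : ℕ → G} {g : G}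

theorem IsSolution.map_eq_of_mapClusterPt (h : IsSolution μ P η ξ)
    (h' : IsSolution μ P' η' ξ') {n : ℕ}
    (hα : TendstoInDistribution (fun m ω => noiseProd ξ n m ω * α m) atTop (η n) (fun _ => P) P)
    (hα' : TendstoInDistribution (fun m ω => noiseProd ξ' n m ω * α' m) atTop (η' n)
      (fun _ => P') P')
    (hg : MapClusterPt g atTop fun l => (α l)⁻¹ * α' l) :
    P'.map (η' n) = (P.map (η n)).map (· * g) := by
  obtain ⟨U, hU, hUg⟩ := mapClusterPt_iff_ultrafilter.1 hg
  have hlim := (continuous_conv.tendsto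
    (law P (h.measurable_eta n).aemeasurable, diracProba g)).comp
      ((hα.tendsto.mono_left hU).prodMk_nhds ((continuous_diracProba.tendsto g).comp hUg))
  have hξ := fun m => measurable_noiseProd h.measurable_xi n m
  have hξ' := fun m => measurable_noiseProd h'.measurable_xi n m
  have htranslate : ∀ m, P'.map (fun ω => noiseProd ξ' n m ω * α' m)
      = (P.map fun ω => noiseProd ξ n m ω * α m).map (· * ((α m)⁻¹ * α' m)) := fun m => by
    rw [Measure.map_map (measurable_mul_const _) ((hξ m).mul_const _)]
    simp only [Function.comp_def, mul_assoc, mul_inv_cancel_left]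
    have hmul := congrArg (Measure.map (· * α' m)) (h'.map_noiseProd_eq h n m)
    rwa [Measure.map_map (measurable_mul_const _) (hξ' m),
      Measure.map_map (measurable_mul_const _) (hξ m)] at hmul
  have heq := tendsto_nhds_unique_of_eventuallyEq (hα'.tendsto.mono_left hU) hlim
    (.of_forall fun m => ProbabilityMeasure.toMeasure_injective ((htranslate m).trans
      (toMeasure_conv_diracProba (law P ((hξ m).mul_const _).aemeasurable) _).symm))
  exact (congrArg ((↑) : ProbabilityMeasure G → Measure G) heq).trans
    (toMeasure_conv_diracProba _ _)

variable {H H' : Subgroup G} [CompactSpace H] [CompactSpace H']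

theorem Conditions.pathLaw_eq_of_mapClusterPt (hc : Conditions P η ξ α H)
    (hc' : Conditions P' η' ξ' α' H') (h : IsSolution μ P η ξ) (h' : IsSolution μ P' η' ξ')
    (hg : MapClusterPt g atTop fun l => (α l)⁻¹ * α' l) :
    pathLaw P' η' = pathLaw P fun n ω => η n ω * g :=
  h'.pathLaw_eq_of_map_eq (h.mul_right g) fun n =>
    (h.map_eq_of_mapClusterPt h' (hc.E1 n) (hc'.E1 n) hg).trans
      (Measure.map_map (measurable_mul_const g) (h.measurable_eta n))

theorem Conditions.eq_map_conj_of_mapClusterPt [T2Space G] (hc : Conditions P η ξ α H)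
    (hc' : Conditions P' η' ξ' α' H') (h : IsSolution μ P η ξ) (h' : IsSolution μ P' η' ξ')
    (hg : MapClusterPt g atTop fun l => (α l)⁻¹ * α' l) :
    H' = H.map (MulAut.conj g⁻¹).toMonoidHom := by
  have hmarg := fun n => h.map_eq_of_mapClusterPt h' (hc.E1 n) (hc'.E1 n) hg
  rw [hc'.eq_rightStabilizer h'.measurable_eta, hc.eq_rightStabilizer h.measurable_eta,
    ← rightStabilizer_map_mul_right]
  simp only [hmarg]

end Uniqueness

end Convergence

end BackwardEquation

theorem mainTheorem1 {G : Type*} [Group G] [TopologicalSpace G] [IsTopologicalGroup G]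
    [CompactSpace G] [T2Space G] [SecondCountableTopology G] [MeasurableSpace G] [BorelSpace G]
    (μ : ℕ → ProbabilityMeasure G)
    {Ω : Type*} [MeasurableSpace Ω] (P : Measure Ω) [IsProbabilityMeasure P]
    (η ξ : ℕ → Ω → G) (hηξ : IsExtremalSolution μ P η ξ) :
    (∃ (α : ℕ → G) (H : Subgroup G) (_ : CompactSpace H), Conditions P η ξ α H) ∧
    ∀ (α : ℕ → G) (H : Subgroup G) [CompactSpace H], Conditions P η ξ α H →
      ∀ {Ω' : Type*} [MeasurableSpace Ω'] (P' : Measure Ω') [IsProbabilityMeasure P']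
        (η' ξ' : ℕ → Ω' → G) (α' : ℕ → G) (H' : Subgroup G) [CompactSpace H'],
        IsExtremalSolution μ P' η' ξ' → Conditions P' η' ξ' α' H' →
        ∀ g : G, MapClusterPt g atTop (fun l => (α l)⁻¹ * α' l) →
          pathLaw P' η' = pathLaw P (fun n ω => η n ω * g) ∧
          H' = H.map (MulAut.conj g⁻¹).toMonoidHom := by
  refine ⟨hηξ.exists_conditions, ?_⟩
  intro α H _ hc Ω' _ P' _ η' ξ' α' H' _ hηξ' hc' g hg
  exact ⟨hc.pathLaw_eq_of_mapClusterPt hc' hηξ.isSolution hηξ'.isSolution hg,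
    hc.eq_map_conj_of_mapClusterPt hc' hηξ.isSolution hηξ'.isSolution hg⟩
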